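/- Let $n\ge 1$, let $B_r\subset\mathbb R^n$ be the open ball of radius $r$ centred at $0$, and let $|E|$ denote the Lebesgue measure of $E$. Let $0<\lambda\le\Lambda<\infty$ and let $a=(a_{ij})$ be a (not necessarily symmetric) $n\times n$ matrix of measurable functions on $B_2$ such that, for almost every $x\in B_2$, $$\lambda|\xi|^2\le \sum_{i,j}a_{ij}(x)\xi_i\xi_j\le\Lambda|\xi|^2\quad\text{for all }\xi\in\mathbb R^n,\qquad |a_{ij}(x)|\le\Lambda\quad\text{for all }i,j.$$ Let $u\in H^1(B_2)$ be a subsolution of $-D_j(a_{ij}D_iu)=0$ in $B_2$, that is, $\int_{B_2}\sum_{i,j}a_{ij}\,D_iu\,D_jv\,dx\le 0$ for every nonnegative $v\in H^1_0(B_2)$, and suppose $0\le u\le 1$ a.e. in $B_2$. Let $\kappa>0$ and suppose that $$|\{x\in B_1:u(x)=0\}|\ge\tfrac12|B_1|,\qquad |\{x\in B_1:u(x)\ge\tfrac12\}|\ge\kappa|B_1|.$$ Then $$\bigl|\{x\in B_1:0<u(x)<\tfrac12\}\bigr|\ \ge\ \frac{\kappa^2\,|B_1|}{n^2\,2^{3n+6}\,C_1},\qquad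 C_1=\frac{4n^2\Lambda^2}{\lambda^2}.$$ (Equivalently, the lower bound is $c\,\kappa^2/(C_1|B_1|)$ with $c=|B_1|^2/(n^2 2^{3n+6})$.) -/

import Mathlib

open MeasureTheory Filter Topology
open scoped ContDiff

/-- Smooth functions with compact support contained in `Ω`. -/
def IsTestFunction {n : ℕ} (Ω : Set (EuclideanSpace ℝ (Fin n)))
    (φ : EuclideanSpace ℝ (Fin n) → ℝ) : Prop :=
  ContDiff ℝ ∞ φ ∧ HasCompactSupport φ ∧ tsupport φ ⊆ Ω

/-- `u ∈ H¹(Ω)` with weak gradient `Du`: both are square integrable on `Ω`, and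
`∫ u ∂ᵢφ = - ∫ (Du)ᵢ φ` for all test functions `φ` and all `i`. -/
structure IsH1With {n : ℕ} (Ω : Set (EuclideanSpace ℝ (Fin n)))
    (u : EuclideanSpace ℝ (Fin n) → ℝ)
    (Du : EuclideanSpace ℝ (Fin n) → EuclideanSpace ℝ (Fin n)) : Prop where
  memLp : MemLp u 2 (volume.restrict Ω)
  memLp_grad : MemLp Du 2 (volume.restrict Ω)
  integral_eq : ∀ φ : EuclideanSpace ℝ (Fin n) → ℝ, IsTestFunction Ω φ → ∀ i : Fin n,
    ∫ x in Ω, u x * gradient φ x i = - ∫ x in Ω, Du x i * φ x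

/-- `v ∈ H¹₀(Ω)` with weak gradient `Dv`: `v` lies in the `H¹(Ω)`-closure of the test functions. -/
structure IsH10With {n : ℕ} (Ω : Set (EuclideanSpace ℝ (Fin n)))
    (v : EuclideanSpace ℝ (Fin n) → ℝ)
    (Dv : EuclideanSpace ℝ (Fin n) → EuclideanSpace ℝ (Fin n)) : Prop
    extends IsH1With Ω v Dv where
  exists_approx : ∃ φ : ℕ → EuclideanSpace ℝ (Fin n) → ℝ,
    (∀ k, IsTestFunction Ω (φ k)) ∧
    Tendsto (fun k => eLpNorm (fun x => φ k x - v x) 2 (volume.restrict Ω)) atTop (𝓝 0) ∧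
    Tendsto (fun k => eLpNorm (fun x => gradient (φ k) x - Dv x) 2 (volume.restrict Ω))
      atTop (𝓝 0)

/-- Measurable coefficients `a = (aᵢⱼ)` on `Ω` which are (almost everywhere) uniformly elliptic with
ellipticity constants `0 < lam ≤ Lam`. No symmetry is assumed. -/
structure IsUniformlyElliptic {n : ℕ} (Ω : Set (EuclideanSpace ℝ (Fin n))) (lam Lam : ℝ)
    (a : EuclideanSpace ℝ (Fin n) → Matrix (Fin n) (Fin n) ℝ) : Prop where
  lam_pos : 0 < lam
  lam_le : lam ≤ Lam
  aemeasurable : ∀ i j, AEMeasurable (fun x => a x i j) (volume.restrict Ω)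
  lower : ∀ᵐ x ∂(volume.restrict Ω), ∀ ξ : EuclideanSpace ℝ (Fin n),
    lam * ‖ξ‖ ^ 2 ≤ ∑ i, ∑ j, a x i j * ξ i * ξ j
  upper : ∀ᵐ x ∂(volume.restrict Ω), ∀ ξ : EuclideanSpace ℝ (Fin n),
    ∑ i, ∑ j, a x i j * ξ i * ξ j ≤ Lam * ‖ξ‖ ^ 2
  entry_le : ∀ᵐ x ∂(volume.restrict Ω), ∀ i j, |a x i j| ≤ Lam

/-- `u ∈ H¹(Ω)` is a (weak) subsolution of `-Dⱼ(aᵢⱼ Dᵢ u) = 0` in `Ω`. -/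
def IsSubsolution {n : ℕ} (Ω : Set (EuclideanSpace ℝ (Fin n)))
    (a : EuclideanSpace ℝ (Fin n) → Matrix (Fin n) (Fin n) ℝ)
    (u : EuclideanSpace ℝ (Fin n) → ℝ) : Prop :=
  ∃ Du : EuclideanSpace ℝ (Fin n) → EuclideanSpace ℝ (Fin n), IsH1With Ω u Du ∧
    ∀ (v : EuclideanSpace ℝ (Fin n) → ℝ)
      (Dv : EuclideanSpace ℝ (Fin n) → EuclideanSpace ℝ (Fin n)),
      IsH10With Ω v Dv → (∀ᵐ x ∂(volume.restrict Ω), 0 ≤ v x) →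
      ∫ x in Ω, ∑ i, ∑ j, a x i j * Du x i * Dv x j ≤ 0

/-- The constant `C₁ = 4 n² Λ² / λ²` of the local energy (Caccioppoli) estimate
`∫ η² |Du|² ≤ C₁ ∫ |Dη|² u²`. -/
noncomputable def energyConst (n : ℕ) (lam Lam : ℝ) : ℝ :=
  4 * (n : ℝ) ^ 2 * Lam ^ 2 / lam ^ 2

/-! De Giorgi's argument: a function of controlled Dirichlet energy cannot pass from 0 to 1/2
without spending volume on the values in between. Let A, D, C be the parts of the unit ball B₁ where
u = 0, u ≥ 1/2, 0 < u < 1/2, and let G be a smooth nondecreasing step, equal to 0 on (-∞, 0] and to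
1 on [1/2, ∞).

Energy: testing the subsolution inequality with η²u, where η is a cutoff equal to 1 on B₁, and
absorbing the cross term by Young's inequality bounds ∫|Du|² over B₁ by C₁ · (25/16) · 2ⁿ|B₁|
(`setIntegral_norm_grad_sq_le`).

Isoperimetry: integrating the derivative of G ∘ u along all segments from A to D gives |A||D| ≤
2ⁿ(|A| + |D|) ∫ G'(u)|Du| over B₁. Since G' vanishes off (0, 1/2), only C contributes, and
Cauchy–Schwarz produces the factor |C|^(1/2) (`isoperimetric_le`). Inserting |A| ≥ |B₁|/2, |D| ≥
κ|B₁| and the energy bound, then squaring, bounds |C| from below.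

Both halves rest on one approximation: ηu, extended by zero and mollified, gives test functions
converging in H¹ (`IsH1With.testFunction_mul_isH10With`). This makes η²u an admissible test function
and carries the segment inequality from smooth functions to u. Because G is smooth, the classical
chain rule for the approximants suffices. -/

section Auxiliary

open ContinuousLinearMap (lsmul)
open scoped Convolution ENNReal

/-! ### Mollification in L² -/

section Mollification

variable {G E : Type*} [NormedAddCommGroup G] [NormedSpace ℝ G] [FiniteDimensional ℝ G]
  [MeasurableSpace G] [BorelSpace G] {μ : Measure G} [μ.IsAddHaarMeasure]
  [NormedAddCommGroup E] [NormedSpace ℝ E]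

/-- Jensen's inequality for the square of a nonnegative function on a probability space. -/
lemma lintegral_sq_le_lintegral_sq {α : Type*} [MeasurableSpace α] (ν : Measure α)
    [IsProbabilityMeasure ν] {g : α → ℝ≥0∞} (hg : AEMeasurable g ν) :
    (∫⁻ x, g x ∂ν) ^ 2 ≤ ∫⁻ x, g x ^ 2 ∂ν := by
  have h := ENNReal.lintegral_mul_le_Lp_mul_Lq ν Real.HolderConjugate.two_two hg
    (aemeasurable_const (b := (1 : ℝ≥0∞)))
  simp only [Pi.mul_apply, mul_one, one_pow, ENNReal.one_rpow, lintegral_const, measure_univ,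
    ENNReal.rpow_two] at h
  calc (∫⁻ x, g x ∂ν) ^ 2 ≤ ((∫⁻ x, g x ^ 2 ∂ν) ^ (1 / 2 : ℝ)) ^ 2 := by gcongr
    _ = _ := by
      rw [← ENNReal.rpow_two, ← ENNReal.rpow_mul]; norm_num

/-- The normalised bump is a probability density, so Jensen applies at each point; Tonelli and
translation invariance then remove the averaging. -/
lemma lintegral_enorm_sq_convolution_le (φ : ContDiffBump (0 : G)) {f : G → E}
    (hf : AEStronglyMeasurable f μ) :
    ∫⁻ x, ‖(φ.normed μ ⋆[lsmul ℝ ℝ, μ] f) x‖ₑ ^ 2 ∂μ ≤ ∫⁻ x, ‖f x‖ₑ ^ 2 ∂μ := by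
  set r : G → ℝ≥0∞ := fun t => ENNReal.ofReal (φ.normed μ t) with hr
  have hrm : Measurable r := (φ.continuous_normed (μ := μ)).measurable.ennreal_ofReal
  have hr1 : ∫⁻ t, r t ∂μ = 1 := by
    rw [hr, ← ofReal_integral_eq_lintegral_ofReal φ.integrable_normed
      (ae_of_all _ fun x => φ.nonneg_normed x), φ.integral_normed, ENNReal.ofReal_one]
  have : IsProbabilityMeasure (μ.withDensity r) := ⟨by simpa using hr1⟩
  have hprod : AEMeasurable (fun p : G × G => ‖f (p.1 - p.2)‖ₑ) (μ.prod μ) := by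
    have := (aestronglyMeasurable_const (b := (1 : ℝ)) (μ := μ)).convolution_integrand
      (lsmul ℝ ℝ) hf
    simpa using this.enorm
  have hslice (x : G) : AEMeasurable (fun t => ‖f (x - t)‖ₑ) μ := by
    have := (aestronglyMeasurable_const (b := (1 : ℝ)) (μ := μ)).convolution_integrand_snd
      (lsmul ℝ ℝ) hf x
    simpa using this.enorm
  have hpt (x : G) : ‖(φ.normed μ ⋆[lsmul ℝ ℝ, μ] f) x‖ₑ ^ 2 ≤
      ∫⁻ t, r t * ‖f (x - t)‖ₑ ^ 2 ∂μ := by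
    calc ‖(φ.normed μ ⋆[lsmul ℝ ℝ, μ] f) x‖ₑ ^ 2
        ≤ (∫⁻ t, ‖φ.normed μ t • f (x - t)‖ₑ ∂μ) ^ 2 := by
          rw [convolution_lsmul]; gcongr; exact enorm_integral_le_lintegral_enorm _
      _ = (∫⁻ t, ‖f (x - t)‖ₑ ∂(μ.withDensity r)) ^ 2 := by
          rw [lintegral_withDensity_eq_lintegral_mul₀ hrm.aemeasurable (hslice x)]
          congr 2 with t
          rw [enorm_smul, Real.enorm_eq_ofReal (φ.nonneg_normed t)]; rfl
      _ ≤ ∫⁻ t, ‖f (x - t)‖ₑ ^ 2 ∂(μ.withDensity r) :=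
          lintegral_sq_le_lintegral_sq _ ((hslice x).mono_ac (withDensity_absolutelyContinuous _ _))
      _ = _ := by
          rw [lintegral_withDensity_eq_lintegral_mul₀ hrm.aemeasurable ((hslice x).pow_const 2)]
          rfl
  calc ∫⁻ x, ‖(φ.normed μ ⋆[lsmul ℝ ℝ, μ] f) x‖ₑ ^ 2 ∂μ
      ≤ ∫⁻ x, ∫⁻ t, r t * ‖f (x - t)‖ₑ ^ 2 ∂μ ∂μ := lintegral_mono hpt
    _ = ∫⁻ t, ∫⁻ x, r t * ‖f (x - t)‖ₑ ^ 2 ∂μ ∂μ :=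
        lintegral_lintegral_swap ((hrm.comp measurable_snd).aemeasurable.mul (hprod.pow_const 2))
    _ = ∫⁻ t, r t * ∫⁻ x, ‖f x‖ₑ ^ 2 ∂μ ∂μ := by
        congr 1 with t
        rw [lintegral_const_mul' _ _ ENNReal.ofReal_ne_top,
          lintegral_sub_right_eq_self (fun x => ‖f x‖ₑ ^ 2) t]
    _ = _ := by rw [lintegral_mul_const _ hrm, hr1, one_mul]

lemma eLpNorm_two_eq {α F : Type*} [MeasurableSpace α] [NormedAddCommGroup F] (f : α → F)
    (ν : Measure α) : eLpNorm f 2 ν = (∫⁻ x, ‖f x‖ₑ ^ 2 ∂ν) ^ (1 / 2 : ℝ) := by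
  simp [eLpNorm_eq_lintegral_rpow_enorm_toReal]

lemma eLpNorm_two_convolution_le (φ : ContDiffBump (0 : G)) {f : G → E}
    (hf : AEStronglyMeasurable f μ) :
    eLpNorm (φ.normed μ ⋆[lsmul ℝ ℝ, μ] f) 2 μ ≤ eLpNorm f 2 μ := by
  rw [eLpNorm_two_eq, eLpNorm_two_eq]
  exact ENNReal.rpow_le_rpow (lintegral_enorm_sq_convolution_le φ hf) (by positivity)

/-- Mollifications of a continuous compactly supported function converge in `L²`. -/
lemma tendsto_eLpNorm_convolution_sub_of_continuous [CompleteSpace E]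
    {φ : ℕ → ContDiffBump (0 : G)}
    (hφ : Tendsto (fun k => (φ k).rOut) atTop (𝓝 0)) {g : G → E} (hg : Continuous g)
    (hgc : HasCompactSupport g) :
    Tendsto (fun k => eLpNorm (((φ k).normed μ ⋆[lsmul ℝ ℝ, μ] g) - g) 2 μ) atTop (𝓝 0) := by
  set K := Metric.cthickening 1 (tsupport g)
  have hK : IsCompact K := hgc.isCompact.cthickening
  have hKg : Function.support g ⊆ K :=
    (subset_tsupport g).trans (Metric.self_subset_cthickening _)
  have hlim : Tendsto (fun c : ℝ => ENNReal.ofReal c * μ K ^ (1 / (2 : ℝ≥0∞).toReal))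
      (𝓝[>] 0) (𝓝 0) := by
    have h0 : Tendsto (fun c : ℝ => ENNReal.ofReal c) (𝓝[>] 0) (𝓝 0) := by
      simpa using (ENNReal.continuous_ofReal.tendsto 0).mono_left nhdsWithin_le_nhds
    simpa using ENNReal.Tendsto.mul_const h0
      (.inr (ENNReal.rpow_ne_top_of_nonneg (by positivity) hK.measure_lt_top.ne))
  refine ENNReal.tendsto_nhds_zero.2 fun ε hε => ?_
  -- On the fixed compact `K` a uniform error `c` costs at most c · μ(K)^(1/2) in L². The bump
  -- radius is then taken below 1, to stay in `K`, and below the modulus of continuity of `g` for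
  -- `c`.
  obtain ⟨c, hc, hc0⟩ :=
    ((ENNReal.tendsto_nhds_zero.1 hlim ε hε).and self_mem_nhdsWithin).exists
  obtain ⟨δ, hδ, hgδ⟩ := Metric.uniformContinuous_iff.1
    (hgc.uniformContinuous_of_continuous hg) c hc0
  filter_upwards [hφ.eventually (gt_mem_nhds (lt_min hδ one_pos))] with k hk
  refine le_trans ?_ hc
  refine eLpNorm_sub_le_of_dist_bdd μ (by norm_num) hK.measurableSet (le_of_lt hc0) ?_ ?_ hKg
  · intro x
    refine ContDiffBump.dist_normed_convolution_le hg.aestronglyMeasurable fun y hy => ?_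
    exact (hgδ ((Metric.mem_ball.1 hy).trans (hk.trans_le (min_le_left _ _)))).le
  · refine (support_convolution_subset _).trans ?_
    rintro _ ⟨s, hs, t, ht, rfl⟩
    rw [(φ k).support_normed_eq, mem_ball_zero_iff] at hs
    refine Metric.mem_cthickening_of_dist_le _ t 1 _ (subset_tsupport g ht) ?_
    simpa using (hs.trans (hk.trans_le (min_le_right _ _))).le

/-- Mollifications of an `L²` function converge in `L²`. -/
lemma tendsto_eLpNorm_convolution_sub [CompleteSpace E] {φ : ℕ → ContDiffBump (0 : G)}
    (hφ : Tendsto (fun k => (φ k).rOut) atTop (𝓝 0)) {f : G → E} (hf : MemLp f 2 μ) :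
    Tendsto (fun k => eLpNorm (((φ k).normed μ ⋆[lsmul ℝ ℝ, μ] f) - f) 2 μ) atTop (𝓝 0) := by
  refine ENNReal.tendsto_nhds_zero.2 fun ε hε => ?_
  have hε3 : ε / 3 ≠ 0 := (ENNReal.div_pos hε.ne' (by norm_num)).ne'
  obtain ⟨g, hgc, hfg, hg, hg2⟩ := hf.exists_hasCompactSupport_eLpNorm_sub_le (by norm_num) hε3
  filter_upwards [ENNReal.tendsto_nhds_zero.1
    (tendsto_eLpNorm_convolution_sub_of_continuous (μ := μ) hφ hg hgc) _ hε3.bot_lt] with k hk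
  set ρ := (φ k).normed μ
  have hρ : Continuous ρ := (φ k).continuous_normed
  have hex {h : G → E} (hh : LocallyIntegrable h μ) : ConvolutionExists ρ h (lsmul ℝ ℝ) μ :=
    (φ k).hasCompactSupport_normed.convolutionExists_left _ hρ hh
  have hcont {h : G → E} (hh : LocallyIntegrable h μ) :
      Continuous (ρ ⋆[lsmul ℝ ℝ, μ] h) :=
    (φ k).hasCompactSupport_normed.continuous_convolution_left _ hρ hh
  have hgl := hg2.locallyIntegrable (by norm_num)
  have hd := hf.sub hg2
  have hdl := hd.locallyIntegrable (by norm_num)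
  have hsplit : (ρ ⋆[lsmul ℝ ℝ, μ] f) - f =
      (ρ ⋆[lsmul ℝ ℝ, μ] (f - g)) + (((ρ ⋆[lsmul ℝ ℝ, μ] g) - g) + (g - f)) := by
    have : f = (f - g) + g := by simp
    conv_lhs => rw [this, (hex hdl).distrib_add (hex hgl)]
    abel
  rw [hsplit]
  calc _ ≤ eLpNorm (ρ ⋆[lsmul ℝ ℝ, μ] (f - g)) 2 μ +
        (eLpNorm ((ρ ⋆[lsmul ℝ ℝ, μ] g) - g) 2 μ + eLpNorm (g - f) 2 μ) := by
        refine (eLpNorm_add_le (hcont hdl).aestronglyMeasurable ?_ (by norm_num)).trans ?_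
        · exact ((hcont hgl).aestronglyMeasurable.sub hg2.1).add (hg2.1.sub hf.1)
        · gcongr
          exact eLpNorm_add_le ((hcont hgl).aestronglyMeasurable.sub hg2.1) (hg2.1.sub hf.1)
            (by norm_num)
    _ ≤ ε / 3 + (ε / 3 + ε / 3) := by
        gcongr
        · exact (eLpNorm_two_convolution_le (φ k) hd.1).trans hfg
        · rwa [eLpNorm_sub_comm]
    _ = ε := by rw [← add_assoc, ENNReal.add_thirds]

end Mollification

/-! ### Weak gradients: mollification, product rule, membership in H¹₀ -/

section WeakGradient

variable {n : ℕ} {Ω Ω' : Set (EuclideanSpace ℝ (Fin n))}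
  {u : EuclideanSpace ℝ (Fin n) → ℝ} {Du : EuclideanSpace ℝ (Fin n) → EuclideanSpace ℝ (Fin n)}
  {φ ψ η : EuclideanSpace ℝ (Fin n) → ℝ}

lemma gradient_apply_eq_fderiv (φ : EuclideanSpace ℝ (Fin n) → ℝ) (x : EuclideanSpace ℝ (Fin n))
    (i : Fin n) : gradient φ x i = fderiv ℝ φ x (EuclideanSpace.single i 1) := by
  rw [← inner_gradient_left, EuclideanSpace.inner_single_right]
  simp

lemma norm_gradient (φ : EuclideanSpace ℝ (Fin n) → ℝ) (x : EuclideanSpace ℝ (Fin n)) :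
    ‖gradient φ x‖ = ‖fderiv ℝ φ x‖ := by
  simp [gradient]

lemma gradient_mul {x : EuclideanSpace ℝ (Fin n)} (hφ : DifferentiableAt ℝ φ x)
    (hψ : DifferentiableAt ℝ ψ x) :
    gradient (fun y => φ y * ψ y) x = φ x • gradient ψ x + ψ x • gradient φ x := by
  ext i
  simp only [gradient_apply_eq_fderiv, PiLp.add_apply, PiLp.smul_apply, smul_eq_mul]
  rw [fderiv_fun_mul hφ hψ]
  simp

lemma support_gradient_subset (φ : EuclideanSpace ℝ (Fin n) → ℝ) :
    Function.support (gradient φ) ⊆ tsupport φ := by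
  refine subset_trans (fun x hx => ?_) (support_fderiv_subset ℝ (f := φ))
  rw [Function.mem_support] at hx ⊢
  rwa [← norm_ne_zero_iff, ← norm_gradient, norm_ne_zero_iff]

lemma ContDiff.continuous_gradient (hφ : ContDiff ℝ ∞ φ) : Continuous (gradient φ) :=
  (InnerProductSpace.toDual ℝ _).symm.continuous.comp (hφ.continuous_fderiv (by simp))

lemma continuous_apply_euclidean (i : Fin n) :
    Continuous fun y : EuclideanSpace ℝ (Fin n) => y i := by fun_prop

lemma IsTestFunction.mono (h : Ω ⊆ Ω') (hφ : IsTestFunction Ω φ) : IsTestFunction Ω' φ :=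
  ⟨hφ.1, hφ.2.1, hφ.2.2.trans h⟩

lemma IsTestFunction.mul (hφ : IsTestFunction Ω φ) (hψ : ContDiff ℝ ∞ ψ) :
    IsTestFunction Ω (fun x => φ x * ψ x) :=
  ⟨hφ.1.mul hψ, hφ.2.1.mul_right, (tsupport_mul_subset_left (g := ψ)).trans hφ.2.2⟩

lemma IsTestFunction.continuous (hφ : IsTestFunction Ω φ) : Continuous φ := hφ.1.continuous

lemma IsTestFunction.hasCompactSupport_gradient (hφ : IsTestFunction Ω φ) :
    HasCompactSupport (gradient φ) :=
  hφ.2.1.mono' (support_gradient_subset φ)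

lemma IsTestFunction.eq_zero (hφ : IsTestFunction Ω φ) {x} (hx : x ∉ Ω) : φ x = 0 :=
  image_eq_zero_of_notMem_tsupport fun h => hx (hφ.2.2 h)

lemma IsTestFunction.gradient_eq_zero (hφ : IsTestFunction Ω φ) {x} (hx : x ∉ Ω) :
    gradient φ x = 0 :=
  Function.notMem_support.1 fun h => hx (hφ.2.2 (support_gradient_subset φ h))

lemma IsH1With.mono (h : Ω ⊆ Ω') (hu : IsH1With Ω' u Du) : IsH1With Ω u Du where
  memLp := hu.memLp.mono_measure (Measure.restrict_mono h le_rfl)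
  memLp_grad := hu.memLp_grad.mono_measure (Measure.restrict_mono h le_rfl)
  integral_eq ψ hψ i := by
    have key {f : EuclideanSpace ℝ (Fin n) → ℝ} (hf : ∀ x ∉ Ω, f x = 0) :
        ∫ x in Ω, f x = ∫ x in Ω', f x :=
      (setIntegral_eq_integral_of_forall_compl_eq_zero hf).trans
        (setIntegral_eq_integral_of_forall_compl_eq_zero fun x hx => hf x fun h' => hx (h h')).symm
    rw [key, key, hu.integral_eq ψ (hψ.mono h) i]
    · intro x hx; rw [hψ.eq_zero hx, mul_zero]
    · intro x hx; rw [hψ.gradient_eq_zero hx]; simp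

lemma memLp_apply {ν : Measure (EuclideanSpace ℝ (Fin n))} (h : MemLp Du 2 ν) (i : Fin n) :
    MemLp (fun x => Du x i) 2 ν :=
  h.of_le ((continuous_apply_euclidean i).comp_aestronglyMeasurable h.1)
    (ae_of_all _ fun x => PiLp.norm_apply_le (Du x) i)

/-- The mollification of a weakly differentiable function has the mollified gradient. -/
lemma gradient_convolution (hu : IsH1With Set.univ u Du)
    (b : ContDiffBump (0 : EuclideanSpace ℝ (Fin n))) :
    gradient (b.normed volume ⋆[lsmul ℝ ℝ, volume] u) =
      b.normed volume ⋆[lsmul ℝ ℝ, volume] Du := by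
  set ρ := b.normed volume
  have hρ : ContDiff ℝ ∞ ρ := b.contDiff_normed
  have hρc : HasCompactSupport ρ := b.hasCompactSupport_normed
  have hu2 : LocallyIntegrable u volume := by
    simpa using hu.memLp.locallyIntegrable (by norm_num)
  have hDu2 : LocallyIntegrable Du volume := by
    simpa using hu.memLp_grad.locallyIntegrable (by norm_num)
  ext x i
  -- The weak formula is tested with the reflected kernel; the sign from differentiating in `t`
  -- cancels the sign of the integration by parts.
  have hψ : IsTestFunction Set.univ (fun t => ρ (x - t)) := by
    refine ⟨hρ.comp (contDiff_const.sub contDiff_id), ?_, Set.subset_univ _⟩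
    exact hρc.comp_homeomorph (Homeomorph.subLeft x)
  have hgrad (t) : gradient (fun t => ρ (x - t)) t i =
      - fderiv ℝ ρ (x - t) (EuclideanSpace.single i 1) := by
    rw [gradient_apply_eq_fderiv]
    have h1 : HasFDerivAt (fun t => x - t)
        (-ContinuousLinearMap.id ℝ (EuclideanSpace ℝ (Fin n))) t := by
      simpa using (hasFDerivAt_id t).const_sub x
    have h2 : fderiv ℝ (fun t => ρ (x - t)) t = _ :=
      ((hρ.differentiable (by simp) (x - t)).hasFDerivAt.comp t h1).fderiv
    rw [h2]
    simp
  have hL := (hρc.hasFDerivAt_convolution_left (lsmul ℝ ℝ) (hρ.of_le (by simp)) hu2 x).fderiv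
  have hexL : ConvolutionExistsAt (fderiv ℝ ρ) u x
      (ContinuousLinearMap.precompL _ (lsmul ℝ ℝ)) volume :=
    hρc.fderiv (𝕜 := ℝ) |>.convolutionExists_left _ (hρ.continuous_fderiv (by simp)) hu2 x
  have hexR : ConvolutionExistsAt ρ Du x (lsmul ℝ ℝ) volume :=
    hρc.convolutionExists_left _ hρ.continuous hDu2 x
  rw [gradient_apply_eq_fderiv, hL, convolution_eq_swap, convolution_eq_swap,
    ContinuousLinearMap.integral_apply hexL.integrable_swap]
  have hR := (EuclideanSpace.proj (𝕜 := ℝ) i).integral_comp_comm hexR.integrable_swap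
  have := hu.integral_eq _ hψ i
  simp only [hgrad, Measure.restrict_univ, mul_neg, integral_neg, neg_inj] at this
  refine Eq.trans ?_ hR
  simpa [ContinuousLinearMap.precompL_apply, mul_comm] using this

/-- Product rule for a test function and a Sobolev function, extended by zero. -/
lemma IsH1With.testFunction_mul (hΩ : MeasurableSet Ω) (hu : IsH1With Ω u Du)
    (hη : IsTestFunction Ω η) :
    IsH1With Set.univ (fun x => η x * u x) (fun x => η x • Du x + u x • gradient η x) := by
  obtain ⟨M, hM⟩ := hη.2.1.exists_bound_of_continuous hη.continuous
  obtain ⟨M', hM'⟩ := hη.hasCompactSupport_gradient.exists_bound_of_continuous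
    hη.1.continuous_gradient
  have hz1 : ∀ x ∉ Ω, η x * u x = 0 := fun x hx => by simp [hη.eq_zero hx]
  have hz2 : ∀ x ∉ Ω, η x • Du x + u x • gradient η x = 0 := fun x hx => by
    simp [hη.eq_zero hx, hη.gradient_eq_zero hx]
  have hη0 := hη.continuous.aestronglyMeasurable (μ := volume.restrict Ω)
  have hη1 := hη.1.continuous_gradient.aestronglyMeasurable (μ := volume.restrict Ω)
  refine ⟨?_, ?_, fun ψ hψ i => ?_⟩
  · rw [Measure.restrict_univ, ← Set.indicator_eq_self.2 (Function.support_subset_iff'.2 hz1),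
      memLp_indicator_iff_restrict hΩ]
    exact hu.memLp.of_le_mul (c := M) (hη0.mul hu.memLp.1) (ae_of_all _ fun x => by
      rw [norm_mul]; gcongr; exact hM x)
  · rw [Measure.restrict_univ, ← Set.indicator_eq_self.2 (Function.support_subset_iff'.2 hz2),
      memLp_indicator_iff_restrict hΩ]
    refine MemLp.add ?_ ?_
    · exact hu.memLp_grad.of_le_mul (c := M) (hη0.smul hu.memLp_grad.1) (ae_of_all _ fun x => by
        rw [norm_smul]; gcongr; exact hM x)
    · exact hu.memLp.of_le_mul (c := M') (hu.memLp.1.smul hη1) (ae_of_all _ fun x => by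
        rw [norm_smul, mul_comm]; gcongr; exact hM' x)
  · have hψc : Continuous fun x => gradient ψ x i :=
      (continuous_apply_euclidean i).comp hψ.1.continuous_gradient
    have hηc : Continuous fun x => gradient η x i :=
      (continuous_apply_euclidean i).comp hη.1.continuous_gradient
    have hint {f g : EuclideanSpace ℝ (Fin n) → ℝ} (hf : MemLp f 2 (volume.restrict Ω))
        (hg : Continuous g) : Integrable (fun x => f x * (η x * g x)) (volume.restrict Ω) :=
      hf.integrable_mul
        ((hη.continuous.mul hg).memLp_of_hasCompactSupport (p := 2) (hη.2.1.mul_right))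
    have hint' : Integrable (fun x => u x * (gradient η x i * ψ x)) (volume.restrict Ω) := by
      refine hu.memLp.integrable_mul ((hηc.mul hψ.continuous).memLp_of_hasCompactSupport (p := 2) ?_)
      exact hψ.2.1.mul_left
    -- Testing `u` with η·ψ splits off the term u ∂ᵢη ψ, which becomes the second summand of the new
    -- gradient.
    have h := hu.integral_eq _ (hη.mul hψ.1) i
    simp only [Measure.restrict_univ]
    rw [← setIntegral_eq_integral_of_forall_compl_eq_zero (s := Ω)
        (f := fun x => η x * u x * gradient ψ x i) (fun x hx => by rw [hz1 x hx, zero_mul]),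
      ← setIntegral_eq_integral_of_forall_compl_eq_zero (s := Ω)
        (f := fun x => (η x • Du x + u x • gradient η x) i * ψ x)
        (fun x hx => by rw [hz2 x hx]; simp)]
    have e1 (x) : u x * gradient (fun y => η y * ψ y) x i =
        u x * (η x * gradient ψ x i) + u x * (gradient η x i * ψ x) := by
      rw [gradient_mul (hη.1.differentiable (by simp) x) (hψ.1.differentiable (by simp) x)]
      simp; ring
    have e2 (x) : (η x • Du x + u x • gradient η x) i * ψ x =
        Du x i * (η x * ψ x) + u x * (gradient η x i * ψ x) := by
      simp; ring
    simp only [e1] at h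
    rw [integral_add (hint hu.memLp hψc) hint'] at h
    simp only [e2]
    rw [integral_add (hint (memLp_apply hu.memLp_grad i) hψ.continuous) hint', neg_add, ← h]
    simp only [add_neg_cancel_right]
    congr 1 with x
    ring

/-- The product of a test function and a Sobolev function lies in `H¹₀`. -/
lemma IsH1With.testFunction_mul_isH10With (hΩ : IsOpen Ω) (hu : IsH1With Ω u Du)
    (hη : IsTestFunction Ω η) :
    IsH10With Ω (fun x => η x * u x) (fun x => η x • Du x + u x • gradient η x) := by
  have hw := hu.testFunction_mul hΩ.measurableSet hη
  set w := fun x => η x * u x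
  set Dw := fun x => η x • Du x + u x • gradient η x
  have hw2 : MemLp w 2 volume := by simpa using hw.memLp
  have hDw2 : MemLp Dw 2 volume := by simpa using hw.memLp_grad
  -- Bump radii δ/(k+1) never exceed δ, so every mollification keeps its support inside Ω.
  obtain ⟨δ, hδ, hδΩ⟩ := hη.2.1.isCompact.exists_cthickening_subset_open hΩ hη.2.2
  set b : ℕ → ContDiffBump (0 : EuclideanSpace ℝ (Fin n)) := fun k =>
    ⟨δ / (k + 1) / 2, δ / (k + 1), by positivity, half_lt_self (by positivity)⟩
  have hb : Tendsto (fun k => (b k).rOut) atTop (𝓝 0) :=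
    tendsto_const_nhds.div_atTop (tendsto_natCast_atTop_atTop.atTop_add tendsto_const_nhds)
  have hle {F : Type} [NormedAddCommGroup F] {f : ℕ → EuclideanSpace ℝ (Fin n) → F}
      (hf : Tendsto (fun k => eLpNorm (f k) 2 volume) atTop (𝓝 0)) :
      Tendsto (fun k => eLpNorm (f k) 2 (volume.restrict Ω)) atTop (𝓝 0) :=
    tendsto_of_tendsto_of_tendsto_of_le_of_le tendsto_const_nhds hf (fun _ => zero_le)
      fun k => eLpNorm_mono_measure _ Measure.restrict_le_self
  refine ⟨hw.mono (Set.subset_univ _),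
    fun k => (b k).normed volume ⋆[lsmul ℝ ℝ, volume] w, fun k => ⟨?_, ?_, ?_⟩, ?_, ?_⟩
  · exact (b k).hasCompactSupport_normed.contDiff_convolution_left _ (b k).contDiff_normed
      (hw2.locallyIntegrable (by norm_num))
  · exact (b k).hasCompactSupport_normed.convolution _ hη.2.1.mul_right
  · refine (closure_minimal ?_ Metric.isClosed_cthickening).trans hδΩ
    refine (support_convolution_subset _).trans ?_
    rintro _ ⟨s, hs, t, ht, rfl⟩
    rw [(b k).support_normed_eq, mem_ball_zero_iff] at hs
    refine Metric.mem_cthickening_of_dist_le _ t δ _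
      (subset_tsupport η (left_ne_zero_of_mul ht)) ?_
    have : δ / (k + 1) ≤ δ := div_le_self hδ.le (by simp)
    simpa using hs.le.trans this
  · exact hle (tendsto_eLpNorm_convolution_sub hb hw2)
  · simp only [gradient_convolution hw]
    exact hle (tendsto_eLpNorm_convolution_sub hb hDw2)

end WeakGradient

/-! ### Smooth steps and cutoffs with explicit slopes -/

section SmoothStep

/-- A smooth step from `0` to `1` on `(a, b)` with slope at most `m`, for any `m > 1 / (b - a)`. -/
lemma exists_smooth_step {a b m : ℝ} (hab : a < b) (hm : 1 < m * (b - a)) :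
    ∃ P : ℝ → ℝ, ContDiff ℝ ∞ P ∧ (∀ t ≤ a, P t = 0) ∧ (∀ t, b ≤ t → P t = 1) ∧
      (∀ t, 0 ≤ deriv P t) ∧ (∀ t, deriv P t ≤ m) ∧ ∀ t ∉ Set.Ioo a b, deriv P t = 0 := by
  have hba : 0 < b - a := sub_pos.2 hab
  have hm0 : 0 < m := pos_of_mul_pos_left (one_pos.trans hm) hba.le
  have hr : 1 / (2 * m) < (b - a) / 2 := by
    rw [div_lt_div_iff₀ (by positivity) two_pos]; linarith
  -- A normalised bump is at most the inverse length of its inner interval, here 1/m, which gives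
  -- the slope bound m. The hypothesis m(b - a) > 1 says exactly that the inner radius is below the
  -- outer one.
  let φ : ContDiffBump ((a + b) / 2) := ⟨1 / (2 * m), (b - a) / 2, by positivity, hr⟩
  set f := φ.normed volume with hf
  have hfc : Continuous f := φ.continuous_normed
  have hsupp : Function.support f = Set.Ioo a b := by
    rw [hf, φ.support_normed_eq, Real.ball_eq_Ioo]
    congr 1 <;> simp only [φ] <;> ring
  have hf0 : ∀ t ∉ Set.Ioo a b, f t = 0 := fun t ht => by
    rwa [← hsupp, Function.notMem_support] at ht
  have hd : ∀ t, HasDerivAt (fun t => ∫ s in a..t, f s) (f t) t := fun t =>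
    intervalIntegral.integral_hasDerivAt_right (hfc.intervalIntegrable _ _)
      (hfc.stronglyMeasurableAtFilter _ _) hfc.continuousAt
  have hderiv : deriv (fun t => ∫ s in a..t, f s) = f := funext fun t => (hd t).deriv
  refine ⟨fun t => ∫ s in a..t, f s, ?_, ?_, ?_, ?_, ?_, ?_⟩
  · exact contDiff_infty_iff_deriv.2 ⟨fun t => (hd t).differentiableAt,
      by rw [hderiv]; exact φ.contDiff_normed⟩
  · intro t ht
    refine (intervalIntegral.integral_congr (g := fun _ => 0) fun s hs => ?_).trans (by simp)
    rw [Set.uIcc_of_ge ht] at hs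
    exact hf0 s fun h => h.1.not_ge hs.2
  · intro t ht
    change ∫ s in a..t, f s = 1
    rw [intervalIntegral.integral_eq_integral_of_support_subset, hf, φ.integral_normed]
    rw [hsupp]
    exact fun s hs => ⟨hs.1, hs.2.le.trans ht⟩
  · intro t; rw [hderiv]; exact φ.nonneg_normed t
  · intro t
    rw [hderiv]
    refine (φ.normed_le_div_measure_closedBall_rIn volume t).trans_eq ?_
    rw [Real.closedBall_eq_Icc, Real.volume_real_Icc_of_le] <;> simp only [φ]
    · field_simp; ring
    · have : 0 < 1 / (2 * m) := by positivity
      linarith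
  · rw [hderiv]; exact hf0

/-- A cutoff function between the balls of radius `1` and `2`, with slope at most `5 / 4`. -/
lemma exists_cutoff (n : ℕ) : ∃ η : EuclideanSpace ℝ (Fin n) → ℝ,
    IsTestFunction (Metric.ball 0 2) η ∧ (∀ x ∈ Metric.ball 0 1, η x = 1) ∧
      ∀ x, ‖gradient η x‖ ≤ 5 / 4 := by
  obtain ⟨P, hP, hP0, hP1, hPd, hPm, -⟩ :=
    -- Stopping at 19/10 keeps the closed support inside the open ball of radius 2; the slope is
    -- admissible because (5/4)(9/10) > 1.
    exists_smooth_step (a := 1) (b := 19 / 10) (m := 5 / 4) (by norm_num) (by norm_num)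
  have hone : ∀ x ∈ Metric.ball (0 : EuclideanSpace ℝ (Fin n)) 1, 1 - P ‖x‖ = 1 := fun x hx => by
    rw [hP0 _ (mem_ball_zero_iff.1 hx).le, sub_zero]
  have hts : tsupport (fun x : EuclideanSpace ℝ (Fin n) => 1 - P ‖x‖) ⊆
      Metric.closedBall 0 (19 / 10) := by
    refine closure_minimal (fun x hx => ?_) Metric.isClosed_closedBall
    rw [mem_closedBall_zero_iff]
    by_contra! h
    exact hx (by simp [hP1 _ h.le])
  refine ⟨fun x => 1 - P ‖x‖, ⟨?_, ?_, ?_⟩, hone, fun x => ?_⟩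
  · refine contDiff_iff_contDiffAt.2 fun x => ?_
    rcases eq_or_ne x 0 with rfl | hx
    · refine (contDiffAt_const (c := (1 : ℝ))).congr_of_eventuallyEq ?_
      filter_upwards [Metric.ball_mem_nhds 0 one_pos] with y hy using hone y hy
    · exact contDiffAt_const.sub (hP.contDiffAt.comp x (contDiffAt_norm ℝ hx))
  · exact (isCompact_closedBall _ _).of_isClosed_subset (isClosed_tsupport _) hts
  · exact hts.trans (Metric.closedBall_subset_ball (by norm_num))
  · have hlip : LipschitzWith (5 / 4) P :=
      lipschitzWith_of_nnnorm_deriv_le (hP.differentiable (by simp)) fun t => by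
        rw [← NNReal.coe_le_coe, coe_nnnorm, Real.norm_of_nonneg (hPd t)]
        simpa using hPm t
    have hl : LipschitzWith (5 / 4) (fun x : EuclideanSpace ℝ (Fin n) => 1 - P ‖x‖) := by
      refine LipschitzWith.of_dist_le_mul fun x y => ?_
      rw [dist_sub_left]
      refine (hlip.dist_le_mul _ _).trans ?_
      gcongr
      exact dist_norm_norm_le x y
    rw [norm_gradient]
    simpa using norm_fderiv_le_of_lipschitz ℝ hl (x₀ := x)

end SmoothStep

/-! ### Integration along segments and an L¹ Poincaré inequality -/

section Segments

variable {n : ℕ} {A D B : Set (EuclideanSpace ℝ (Fin n))}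

lemma lintegral_comp_smul_add {h : EuclideanSpace ℝ (Fin n) → ℝ≥0∞} (hh : Measurable h) {r : ℝ}
    (hr : 0 < r) (v : EuclideanSpace ℝ (Fin n)) :
    ∫⁻ x, h (r • x + v) = ENNReal.ofReal ((r ^ n)⁻¹) * ∫⁻ x, h x := by
  have hm : Measurable fun x => h (x + v) := hh.comp (measurable_id.add_const v)
  have e := lintegral_map (μ := (volume : Measure (EuclideanSpace ℝ (Fin n)))) hm
    (measurable_const_smul r)
  rw [Measure.map_addHaar_smul volume hr.ne', lintegral_smul_measure,
    lintegral_add_right_eq_self h v, finrank_euclideanSpace_fin, abs_of_nonneg (by positivity)] at e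
  exact e.symm

/-- Contracting a convex set towards one of its points, by a factor at least `1 / 2`. -/
lemma setLIntegral_comp_segment_le (hB : Convex ℝ B) (hBm : MeasurableSet B) (hA : A ⊆ B)
    {h : EuclideanSpace ℝ (Fin n) → ℝ≥0∞} (hh : Measurable h) {t : ℝ} (ht0 : 0 ≤ t)
    (ht : t ≤ 1 / 2) {y : EuclideanSpace ℝ (Fin n)} (hy : y ∈ B) :
    ∫⁻ x in A, h ((1 - t) • x + t • y) ≤ 2 ^ n * ∫⁻ x in B, h x := by
  have h1t : 0 < 1 - t := by linarith
  calc ∫⁻ x in A, h ((1 - t) • x + t • y)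
      ≤ ∫⁻ x in B, h ((1 - t) • x + t • y) := lintegral_mono_set hA
    _ = ∫⁻ x in B, B.indicator h ((1 - t) • x + t • y) := by
        refine setLIntegral_congr_fun hBm fun x hx => ?_
        rw [Set.indicator_of_mem (hB hx hy h1t.le ht0 (by ring))]
    _ ≤ ∫⁻ x, B.indicator h ((1 - t) • x + t • y) := setLIntegral_le_lintegral _ _
    _ = ENNReal.ofReal (((1 - t) ^ n)⁻¹) * ∫⁻ x in B, h x := by
        rw [lintegral_comp_smul_add (hh.indicator hBm) h1t, lintegral_indicator hBm]
    _ ≤ 2 ^ n * ∫⁻ x in B, h x := by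
        gcongr
        rw [← inv_pow, ENNReal.ofReal_pow (by positivity)]
        gcongr
        rw [ENNReal.ofReal_le_ofNat]
        exact inv_le_of_inv_le₀ two_pos (by linarith)

lemma measurable_segment : Measurable
    fun q : (EuclideanSpace ℝ (Fin n) × EuclideanSpace ℝ (Fin n)) × ℝ =>
      (1 - q.2) • q.1.1 + q.2 • q.1.2 := by fun_prop

/-- The integral of a nonnegative function over all segments joining `A` to `D` in a convex set. -/
lemma lintegral_segments_le (hB : Convex ℝ B) (hBm : MeasurableSet B) (hA : A ⊆ B) (hD : D ⊆ B)
    {h : EuclideanSpace ℝ (Fin n) → ℝ≥0∞} (hh : Measurable h) :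
    2 * ∫⁻ p, (∫⁻ t in Set.Ioc (0 : ℝ) 1, h ((1 - t) • p.1 + t • p.2))
        ∂((volume.restrict A).prod (volume.restrict D)) ≤
      2 ^ n * (volume A + volume D) * ∫⁻ x in B, h x := by
  set J := ∫⁻ x in B, h x
  have hm := hh.comp (measurable_segment (n := n))
  have hmt (t : ℝ) : Measurable
      fun p : EuclideanSpace ℝ (Fin n) × EuclideanSpace ℝ (Fin n) =>
        h ((1 - t) • p.1 + t • p.2) := hm.comp (measurable_id.prodMk measurable_const)
  have hB1 : ∀ᵐ x ∂(volume.restrict A), x ∈ B :=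
    (ae_restrict_mem hBm).filter_mono (ae_mono (Measure.restrict_mono hA le_rfl))
  have hB2 : ∀ᵐ x ∂(volume.restrict D), x ∈ B :=
    (ae_restrict_mem hBm).filter_mono (ae_mono (Measure.restrict_mono hD le_rfl))
  -- For t ≤ 1/2 the variable in `A` is integrated first, for t > 1/2 the one in `D`; the
  -- contraction factor is then at least 1/2 and the Jacobian costs at most 2ⁿ.
  have hI1 (t : ℝ) (ht : t ∈ Set.Ioc (0 : ℝ) (1 / 2)) :
      ∫⁻ p, h ((1 - t) • p.1 + t • p.2) ∂((volume.restrict A).prod (volume.restrict D)) ≤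
        2 ^ n * J * volume D := by
    rw [lintegral_prod_symm' _ (hmt t)]
    calc _ ≤ ∫⁻ _ in D, 2 ^ n * J := by
          refine lintegral_mono_ae ?_
          filter_upwards [hB2] with y hy
          exact setLIntegral_comp_segment_le hB hBm hA hh ht.1.le ht.2 hy
      _ = _ := by rw [setLIntegral_const]
  have hI2 (t : ℝ) (ht : t ∈ Set.Ioc (1 / 2 : ℝ) 1) :
      ∫⁻ p, h ((1 - t) • p.1 + t • p.2) ∂((volume.restrict A).prod (volume.restrict D)) ≤
        2 ^ n * J * volume A := by
    rw [lintegral_prod _ (hmt t).aemeasurable]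
    calc _ ≤ ∫⁻ _ in A, 2 ^ n * J := by
          refine lintegral_mono_ae ?_
          filter_upwards [hB1] with x hx
          have := setLIntegral_comp_segment_le hB hBm hD hh (t := 1 - t) (by linarith [ht.2])
            (by linarith [ht.1]) hx
          simpa [add_comm] using this
      _ = _ := by rw [setLIntegral_const]
  rw [lintegral_lintegral_swap
      (f := fun (p : EuclideanSpace ℝ (Fin n) × EuclideanSpace ℝ (Fin n)) t =>
        h ((1 - t) • p.1 + t • p.2)) hm.aemeasurable,
    ← Set.Ioc_union_Ioc_eq_Ioc (b := (1 / 2 : ℝ)) (by norm_num) (by norm_num),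
    lintegral_union measurableSet_Ioc
      (Set.Ioc_disjoint_Ioc_of_le le_rfl)]
  have hhalf (a b : ℝ) (hab : b - a = 1 / 2) (c : ℝ≥0∞) :
      2 * ∫⁻ _ in Set.Ioc a b, c = c := by
    rw [setLIntegral_const, Real.volume_Ioc, hab, mul_comm c, ← mul_assoc, one_div,
      ENNReal.ofReal_inv_of_pos two_pos, ENNReal.ofReal_ofNat,
      ENNReal.mul_inv_cancel (by norm_num) (by norm_num), one_mul]
  calc _ ≤ 2 * ((∫⁻ _ in Set.Ioc (0 : ℝ) (1 / 2), 2 ^ n * J * volume D) +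
        ∫⁻ _ in Set.Ioc (1 / 2 : ℝ) 1, 2 ^ n * J * volume A) := by
        gcongr 2 * (?_ + ?_)
        · exact setLIntegral_mono measurable_const hI1
        · exact setLIntegral_mono measurable_const hI2
    _ = 2 ^ n * J * volume D + 2 ^ n * J * volume A := by
        rw [mul_add, hhalf _ _ (by norm_num), hhalf _ _ (by norm_num)]
    _ = _ := by ring

lemma enorm_sub_le_lintegral_segment {g : EuclideanSpace ℝ (Fin n) → ℝ} (hg : ContDiff ℝ 1 g)
    (x y : EuclideanSpace ℝ (Fin n)) :
    ‖g y - g x‖ₑ ≤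
      ‖y - x‖ₑ * ∫⁻ t in Set.Ioc (0 : ℝ) 1, ‖gradient g ((1 - t) • x + t • y)‖ₑ := by
  have hγ (t : ℝ) : HasDerivAt (fun t : ℝ => (1 - t) • x + t • y) (y - x) t := by
    have h := (((hasDerivAt_id t).const_sub 1).smul_const x).add ((hasDerivAt_id t).smul_const y)
    rwa [show (-1 : ℝ) • x + (1 : ℝ) • y = y - x by module] at h
  have hd (t : ℝ) : HasDerivAt (fun t : ℝ => g ((1 - t) • x + t • y))
      (fderiv ℝ g ((1 - t) • x + t • y) (y - x)) t :=
    (hg.differentiable (by simp) _).hasFDerivAt.comp_hasDerivAt t (hγ t)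
  have hcont : Continuous fun t : ℝ => fderiv ℝ g ((1 - t) • x + t • y) (y - x) :=
    ((hg.continuous_fderiv (by simp)).comp (by fun_prop)).clm_apply continuous_const
  have hftc := intervalIntegral.integral_eq_sub_of_hasDerivAt (a := 0) (b := 1)
    (fun t _ => hd t) (hcont.intervalIntegrable _ _)
  simp only [sub_self, zero_smul, one_smul, zero_add, sub_zero, add_zero] at hftc
  rw [← hftc, intervalIntegral.integral_of_le zero_le_one,
    ← lintegral_const_mul' _ _ enorm_ne_top]
  refine (enorm_integral_le_lintegral_enorm _).trans (lintegral_mono fun t => ?_)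
  refine (ContinuousLinearMap.le_opENorm _ _).trans_eq ?_
  rw [mul_comm, ← ofReal_norm (fderiv ℝ g _), ← norm_gradient, ofReal_norm]

/-- An `L¹` Poincaré type inequality between two subsets of the unit ball. -/
lemma measure_mul_integral_sub_le {g : EuclideanSpace ℝ (Fin n) → ℝ} (hg : ContDiff ℝ 1 g)
    (hgi : IntegrableOn g (Metric.ball 0 1)) (hA : A ⊆ Metric.ball 0 1)
    (hD : D ⊆ Metric.ball 0 1) :
    ENNReal.ofReal (volume.real A * (∫ y in D, g y) - volume.real D * ∫ x in A, g x) ≤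
      2 ^ n * (volume A + volume D) * ∫⁻ x in Metric.ball 0 1, ‖gradient g x‖ₑ := by
  have hAi := hgi.mono_set hA
  have hDi := hgi.mono_set hD
  have hfin {S : Set (EuclideanSpace ℝ (Fin n))} (hS : S ⊆ Metric.ball 0 1) :
      IsFiniteMeasure (volume.restrict S) :=
    ⟨by simpa using (measure_mono hS).trans_lt measure_ball_lt_top⟩
  have := hfin hA
  have := hfin hD
  set π := (volume.restrict A).prod (volume.restrict D)
  have hgrad : Continuous (gradient g) :=
    (InnerProductSpace.toDual ℝ _).symm.continuous.comp (hg.continuous_fderiv (by simp))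
  have heq : volume.real A * (∫ y in D, g y) - volume.real D * ∫ x in A, g x =
      ∫ p, (g p.2 - g p.1) ∂π := by
    rw [integral_sub (hDi.comp_snd _) (hAi.comp_fst _), integral_fun_snd, integral_fun_fst]
    simp
  have hB (S : Set (EuclideanSpace ℝ (Fin n))) (hS : S ⊆ Metric.ball 0 1) :
      ∀ᵐ x ∂(volume.restrict S), x ∈ Metric.ball (0 : EuclideanSpace ℝ (Fin n)) 1 :=
    (ae_restrict_mem measurableSet_ball).filter_mono (ae_mono (Measure.restrict_mono hS le_rfl))
  rw [heq]
  calc ENNReal.ofReal (∫ p, (g p.2 - g p.1) ∂π)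
      ≤ ‖∫ p, (g p.2 - g p.1) ∂π‖ₑ := by
        rw [← ofReal_norm]
        exact ENNReal.ofReal_le_ofReal (Real.le_norm_self _)
    _ ≤ ∫⁻ p, ‖g p.2 - g p.1‖ₑ ∂π := enorm_integral_le_lintegral_enorm _
    _ ≤ ∫⁻ p, 2 * (∫⁻ t in Set.Ioc (0 : ℝ) 1, ‖gradient g ((1 - t) • p.1 + t • p.2)‖ₑ) ∂π := by
        refine lintegral_mono_ae ?_
        filter_upwards [Measure.quasiMeasurePreserving_fst.ae (hB A hA),
          Measure.quasiMeasurePreserving_snd.ae (hB D hD)] with p hp1 hp2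
        refine (enorm_sub_le_lintegral_segment hg p.1 p.2).trans ?_
        gcongr
        rw [← ofReal_norm, ENNReal.ofReal_le_ofNat]
        rw [mem_ball_zero_iff] at hp1 hp2
        have := norm_sub_le p.2 p.1
        linarith
    _ = 2 * ∫⁻ p, (∫⁻ t in Set.Ioc (0 : ℝ) 1, ‖gradient g ((1 - t) • p.1 + t • p.2)‖ₑ) ∂π :=
        lintegral_const_mul' _ _ (by norm_num)
    _ ≤ _ := lintegral_segments_le (convex_ball 0 1) measurableSet_ball hA hD
        hgrad.measurable.enorm

end Segments

/-! ### The energy estimate -/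

section Caccioppoli

variable {n : ℕ} {lam Lam : ℝ} {a : EuclideanSpace ℝ (Fin n) → Matrix (Fin n) (Fin n) ℝ}
  {u : EuclideanSpace ℝ (Fin n) → ℝ} {Du : EuclideanSpace ℝ (Fin n) → EuclideanSpace ℝ (Fin n)}

/-- The factor n comes from comparing the ℓ¹ norm with √n times the Euclidean norm in each argument;
no symmetry enters. -/
lemma abs_bilinear_le {M : Matrix (Fin n) (Fin n) ℝ} (hM : ∀ i j, |M i j| ≤ Lam)
    (ξ ζ : EuclideanSpace ℝ (Fin n)) :
    |∑ i, ∑ j, M i j * ξ i * ζ j| ≤ n * Lam * (‖ξ‖ * ‖ζ‖) := by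
  rcases Nat.eq_zero_or_pos n with rfl | hn
  · simp
  have hLam : 0 ≤ Lam := (abs_nonneg _).trans (hM ⟨0, hn⟩ ⟨0, hn⟩)
  have hl1 (ξ : EuclideanSpace ℝ (Fin n)) : ∑ i, |ξ i| ≤ √n * ‖ξ‖ := by
    have h := sq_sum_le_card_mul_sum_sq (s := Finset.univ) (f := fun i => |ξ i|)
    rw [← abs_of_nonneg (Finset.sum_nonneg fun i _ => abs_nonneg (ξ i)),
      ← abs_of_nonneg (show 0 ≤ √n * ‖ξ‖ by positivity)]
    refine sq_le_sq.1 ?_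
    rw [mul_pow, Real.sq_sqrt (by positivity), EuclideanSpace.norm_sq_eq]
    simpa using h
  calc |∑ i, ∑ j, M i j * ξ i * ζ j| ≤ ∑ i, ∑ j, Lam * |ξ i| * |ζ j| := by
        refine (Finset.abs_sum_le_sum_abs _ _).trans (Finset.sum_le_sum fun i _ => ?_)
        refine (Finset.abs_sum_le_sum_abs _ _).trans (Finset.sum_le_sum fun j _ => ?_)
        rw [abs_mul, abs_mul]
        gcongr
        exact hM i j
    _ = Lam * ((∑ i, |ξ i|) * ∑ j, |ζ j|) := by
        rw [Finset.sum_mul_sum, Finset.mul_sum]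
        simp only [Finset.mul_sum, mul_assoc]
    _ ≤ Lam * ((√n * ‖ξ‖) * (√n * ‖ζ‖)) := by
        gcongr <;> exact hl1 _
    _ = (√n * √n) * Lam * (‖ξ‖ * ‖ζ‖) := by ring
    _ = _ := by rw [Real.mul_self_sqrt (by positivity)]

/-- The pointwise inequality behind the energy estimate. -/
lemma energy_pointwise {M : Matrix (Fin n) (Fin n) ℝ} (hlam : 0 < lam) (hM : ∀ i j, |M i j| ≤ Lam)
    {ξ : EuclideanSpace ℝ (Fin n)} (hell : lam * ‖ξ‖ ^ 2 ≤ ∑ i, ∑ j, M i j * ξ i * ξ j)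
    (s z : ℝ) (ζ : EuclideanSpace ℝ (Fin n)) :
    lam / 2 * (s ^ 2 * ‖ξ‖ ^ 2) - 2 * (n : ℝ) ^ 2 * Lam ^ 2 / lam * (z ^ 2 * ‖ζ‖ ^ 2) ≤
      ∑ i, ∑ j, M i j * ξ i * ((s * s) • ξ + z • (s • ζ + s • ζ)) j := by
  have hsplit : ∑ i, ∑ j, M i j * ξ i * ((s * s) • ξ + z • (s • ζ + s • ζ)) j =
      s ^ 2 * (∑ i, ∑ j, M i j * ξ i * ξ j) + 2 * (z * s) * ∑ i, ∑ j, M i j * ξ i * ζ j := by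
    simp only [Finset.mul_sum, ← Finset.sum_add_distrib]
    refine Finset.sum_congr rfl fun i _ => Finset.sum_congr rfl fun j _ => ?_
    simp only [PiLp.add_apply, PiLp.smul_apply, smul_eq_mul]
    ring
  rw [hsplit]
  have hb := abs_bilinear_le hM ξ ζ
  set Q := ∑ i, ∑ j, M i j * ξ i * ζ j
  have h1 : -(|z| * |s| * (n * Lam * (‖ξ‖ * ‖ζ‖))) ≤ z * s * Q := by
    have := neg_abs_le (z * s * Q)
    rw [abs_mul, abs_mul] at this
    have h2 : |z| * |s| * |Q| ≤ |z| * |s| * (n * Lam * (‖ξ‖ * ‖ζ‖)) := by gcongr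
    linarith
  -- Young's inequality, weighted so that the cross term consumes exactly half of the ellipticity.
  have h3 : 2 * (|z| * |s| * (n * Lam * (‖ξ‖ * ‖ζ‖))) ≤ lam / 2 * (s ^ 2 * ‖ξ‖ ^ 2) +
      2 * (n : ℝ) ^ 2 * Lam ^ 2 / lam * (z ^ 2 * ‖ζ‖ ^ 2) := by
    have e : lam / 2 * (s ^ 2 * ‖ξ‖ ^ 2) +
        2 * (n : ℝ) ^ 2 * Lam ^ 2 / lam * (z ^ 2 * ‖ζ‖ ^ 2) -
        2 * (|z| * |s| * (n * Lam * (‖ξ‖ * ‖ζ‖))) =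
        (lam * (|s| * ‖ξ‖) - 2 * (n * Lam * (|z| * ‖ζ‖))) ^ 2 / (2 * lam) := by
      rw [← sq_abs s, ← sq_abs z]
      field_simp
      ring
    have : 0 ≤ (lam * (|s| * ‖ξ‖) - 2 * (n * Lam * (|z| * ‖ζ‖))) ^ 2 / (2 * lam) := by
      positivity
    linarith
  have h5 : s ^ 2 * (lam * ‖ξ‖ ^ 2) ≤ s ^ 2 * ∑ i, ∑ j, M i j * ξ i * ξ j := by gcongr
  linarith

lemma integrable_bilinear {ν : Measure (EuclideanSpace ℝ (Fin n))}
    {V W : EuclideanSpace ℝ (Fin n) → EuclideanSpace ℝ (Fin n)}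
    (ham : ∀ i j, AEMeasurable (fun x => a x i j) ν)
    (hab : ∀ᵐ x ∂ν, ∀ i j, |a x i j| ≤ Lam) (hV : MemLp V 2 ν) (hW : MemLp W 2 ν) :
    Integrable (fun x => ∑ i, ∑ j, a x i j * V x i * W x j) ν := by
  refine integrable_finsetSum _ fun i _ => integrable_finsetSum _ fun j _ => ?_
  simp only [mul_assoc]
  refine ((memLp_apply hV i).integrable_mul (memLp_apply hW j)).bdd_mul (c := Lam)
    (ham i j).aestronglyMeasurable ?_
  filter_upwards [hab] with x hx using hx i j

/-- The energy (Caccioppoli) estimate on the unit ball for subsolutions with values in `[0, 1]`. -/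
lemma setIntegral_norm_grad_sq_le (ha : IsUniformlyElliptic (Metric.ball 0 2) lam Lam a)
    (hu : IsH1With (Metric.ball 0 2) u Du)
    (hsub : ∀ (v : EuclideanSpace ℝ (Fin n) → ℝ)
      (Dv : EuclideanSpace ℝ (Fin n) → EuclideanSpace ℝ (Fin n)),
      IsH10With (Metric.ball 0 2) v Dv →
      (∀ᵐ x ∂(volume.restrict (Metric.ball 0 2)), 0 ≤ v x) →
      ∫ x in Metric.ball 0 2, ∑ i, ∑ j, a x i j * Du x i * Dv x j ≤ 0)
    (hu01 : ∀ᵐ x ∂(volume.restrict (Metric.ball (0 : EuclideanSpace ℝ (Fin n)) 2)),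
      0 ≤ u x ∧ u x ≤ 1) :
    ∫ x in Metric.ball 0 1, ‖Du x‖ ^ 2 ≤ energyConst n lam Lam *
      (25 / 16 * (2 ^ n * volume.real (Metric.ball (0 : EuclideanSpace ℝ (Fin n)) 1))) := by
  obtain ⟨η, hη, hη1, hηg⟩ := exists_cutoff n
  have hlam := ha.lam_pos
  set B := Metric.ball (0 : EuclideanSpace ℝ (Fin n)) 2 with hBdef
  set B₁ := Metric.ball (0 : EuclideanSpace ℝ (Fin n)) 1
  have hv := hu.testFunction_mul_isH10With Metric.isOpen_ball (hη.mul hη.1)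
  have hneg := hsub _ _ hv (hu01.mono fun x hx => mul_nonneg (mul_self_nonneg _) hx.1)
  have hint := integrable_bilinear ha.aemeasurable ha.entry_le hu.memLp_grad hv.memLp_grad
  have hsq : IntegrableOn (fun x => ‖Du x‖ ^ 2) B := hu.memLp_grad.integrable_norm_pow two_ne_zero
  have hind : Integrable (B₁.indicator fun x => ‖Du x‖ ^ 2) (volume.restrict B) :=
    hsq.indicator measurableSet_ball
  set c := 2 * (n : ℝ) ^ 2 * Lam ^ 2 / lam * (25 / 16) with hc
  have hc0 : 0 ≤ 2 * (n : ℝ) ^ 2 * Lam ^ 2 / lam := by positivity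
  have hfin : IsFiniteMeasure (volume.restrict B) :=
    ⟨by simpa using measure_ball_lt_top⟩
  -- The energy is kept only on B₁, where η = 1, while the error is bounded by the constant `c` on
  -- all of B₂; hence the factor |B₂| = 2ⁿ|B₁|.
  have hle : ∫ x in B, (lam / 2 * B₁.indicator (fun x => ‖Du x‖ ^ 2) x - c) ≤
      ∫ x in B, ∑ i, ∑ j, a x i j * Du x i *
        ((η x * η x) • Du x + u x • gradient (fun y => η y * η y) x) j := by
    refine integral_mono_ae ((hind.const_mul _).sub (integrable_const c)) hint ?_
    filter_upwards [ha.entry_le, ha.lower, hu01] with x hx1 hx2 hx3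
    have hd := hη.1.differentiable (by simp) x
    simp only [gradient_mul hd hd]
    refine le_trans ?_ (energy_pointwise hlam hx1 (hx2 (Du x)) (η x) (u x) (gradient η x))
    have h1 : B₁.indicator (fun x => ‖Du x‖ ^ 2) x ≤ η x ^ 2 * ‖Du x‖ ^ 2 := by
      by_cases hx : x ∈ B₁
      · rw [Set.indicator_of_mem hx, hη1 x hx]; simp
      · rw [Set.indicator_of_notMem hx]; positivity
    have h2 : u x ^ 2 * ‖gradient η x‖ ^ 2 ≤ 25 / 16 := by
      calc u x ^ 2 * ‖gradient η x‖ ^ 2 ≤ 1 ^ 2 * (5 / 4) ^ 2 := by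
            gcongr
            exacts [hx3.1, hx3.2, hηg x]
        _ = _ := by norm_num
    rw [hc]
    gcongr
  rw [integral_sub (hind.const_mul _) (integrable_const c), integral_const_mul,
    integral_indicator measurableSet_ball, Measure.restrict_restrict measurableSet_ball,
    Set.inter_eq_left.2 (Metric.ball_subset_ball one_le_two), integral_const, smul_eq_mul,
    measureReal_restrict_apply_univ] at hle
  have hvol : volume.real B = 2 ^ n * volume.real B₁ := by
    have := Measure.addHaar_ball_mul_of_pos volume (0 : EuclideanSpace ℝ (Fin n)) two_pos 1
    rw [mul_one, finrank_euclideanSpace_fin] at this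
    rw [Measure.real, hBdef, this, ENNReal.toReal_mul, ENNReal.toReal_ofReal (by positivity)]
    rfl
  have hfinal : lam / 2 * ∫ x in B₁, ‖Du x‖ ^ 2 ≤ 2 ^ n * volume.real B₁ * c := by
    rw [← hvol]; linarith
  have : energyConst n lam Lam * (25 / 16 * (2 ^ n * volume.real B₁)) =
      2 / lam * (2 ^ n * volume.real B₁ * c) := by
    rw [energyConst, hc]; field_simp; ring
  rw [this]
  calc ∫ x in B₁, ‖Du x‖ ^ 2 = 2 / lam * (lam / 2 * ∫ x in B₁, ‖Du x‖ ^ 2) := by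
        field_simp
    _ ≤ _ := by gcongr

end Caccioppoli

/-! ### Passage from smooth functions to H¹ limits -/

section Limit

variable {n : ℕ} {A D : Set (EuclideanSpace ℝ (Fin n))}
  {u : EuclideanSpace ℝ (Fin n) → ℝ} {Du : EuclideanSpace ℝ (Fin n) → EuclideanSpace ℝ (Fin n)}

lemma gradient_comp {G : ℝ → ℝ} {φ : EuclideanSpace ℝ (Fin n) → ℝ} {x : EuclideanSpace ℝ (Fin n)}
    (hG : DifferentiableAt ℝ G (φ x)) (hφ : DifferentiableAt ℝ φ x) :
    gradient (fun y => G (φ y)) x = deriv G (φ x) • gradient φ x := by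
  have h : fderiv ℝ (fun y => G (φ y)) x = _ :=
    (hG.hasDerivAt.comp_hasFDerivAt x hφ.hasFDerivAt).fderiv
  simp [gradient, h]

/-- Extension of `measure_mul_integral_sub_le` to `G ∘ u` where `u` is an `H¹` limit of smooth
functions and `G` is a bounded smooth function with bounded derivative. -/
lemma measure_mul_integral_sub_le_of_tendsto
    {φ : ℕ → EuclideanSpace ℝ (Fin n) → ℝ} (hφ : ∀ k, ContDiff ℝ ∞ (φ k))
    (hum : AEStronglyMeasurable u (volume.restrict (Metric.ball 0 1)))
    (hDu : MemLp Du 2 (volume.restrict (Metric.ball 0 1)))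
    (hlim : Tendsto (fun k => eLpNorm (fun x => φ k x - u x) 2
      (volume.restrict (Metric.ball 0 1))) atTop (𝓝 0))
    (hlim' : Tendsto (fun k => eLpNorm (fun x => gradient (φ k) x - Du x) 2
      (volume.restrict (Metric.ball 0 1))) atTop (𝓝 0))
    {G : ℝ → ℝ} (hG : ContDiff ℝ ∞ G) {M m : ℝ} (hGM : ∀ t, ‖G t‖ ≤ M) (hGm : ∀ t, ‖deriv G t‖ ≤ m)
    (hA : A ⊆ Metric.ball 0 1) (hD : D ⊆ Metric.ball 0 1) :
    ENNReal.ofReal (volume.real A * (∫ y in D, G (u y)) - volume.real D * ∫ x in A, G (u x)) ≤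
      2 ^ n * (volume A + volume D) *
        ∫⁻ x in Metric.ball 0 1, ‖deriv G (u x)‖ₑ * ‖Du x‖ₑ := by
  set ν := volume.restrict (Metric.ball (0 : EuclideanSpace ℝ (Fin n)) 1) with hν
  have hνfin : IsFiniteMeasure ν := ⟨by simpa [hν] using measure_ball_lt_top⟩
  have hφc (k) : Continuous (φ k) := (hφ k).continuous
  have hG'c : Continuous (deriv G) := hG.continuous_deriv (by simp)
  -- Almost everywhere convergence along a subsequence is what lets G(φₖ) and G'(φₖ) pass to the
  -- limit by domination.
  obtain ⟨ns, hns, hae⟩ := (tendstoInMeasure_of_tendsto_eLpNorm two_ne_zero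
    (fun k => (hφc k).aestronglyMeasurable) hum hlim).exists_seq_tendsto_ae
  have hset (S : Set (EuclideanSpace ℝ (Fin n))) (hS : S ⊆ Metric.ball 0 1) :
      Tendsto (fun k => ∫ x in S, G (φ (ns k) x)) atTop (𝓝 (∫ x in S, G (u x))) := by
    have hle : volume.restrict S ≤ ν := Measure.restrict_mono hS le_rfl
    have := isFiniteMeasure_of_le ν hle
    refine tendsto_integral_of_dominated_convergence (fun _ => M)
      (fun k => (hG.continuous.comp (hφc _)).aestronglyMeasurable) (integrable_const M)
      (fun k => ae_of_all _ fun x => hGM _) ?_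
    filter_upwards [ae_mono hle hae] with x hx
    exact (hG.continuous.tendsto _).comp hx
  have hL : Tendsto (fun k => ENNReal.ofReal (volume.real A * (∫ y in D, G (φ (ns k) y)) -
      volume.real D * ∫ x in A, G (φ (ns k) x))) atTop (𝓝 (ENNReal.ofReal
        (volume.real A * (∫ y in D, G (u y)) - volume.real D * ∫ x in A, G (u x)))) :=
    (ENNReal.continuous_ofReal.tendsto _).comp
      (((hset D hD).const_mul _).sub ((hset A hA).const_mul _))
  have hm : ∀ t, ‖deriv G t‖ₑ ≤ ENNReal.ofReal m := fun t => by
    rw [← ofReal_norm]; exact ENNReal.ofReal_le_ofReal (hGm t)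
  have hgc (k) : Continuous (gradient (φ k)) := (hφ k).continuous_gradient
  have hDu1 : ∫⁻ x, ‖Du x‖ₑ ∂ν ≠ ⊤ :=
    (hDu.integrable (by norm_num)).hasFiniteIntegral.ne
  have hR1 : Tendsto (fun k => ∫⁻ x, ‖deriv G (φ (ns k) x)‖ₑ * ‖Du x‖ₑ ∂ν) atTop
      (𝓝 (∫⁻ x, ‖deriv G (u x)‖ₑ * ‖Du x‖ₑ ∂ν)) := by
    refine tendsto_lintegral_of_dominated_convergence'
      (fun x => ENNReal.ofReal m * ‖Du x‖ₑ) (fun k => ?_) (fun k => ?_) ?_ ?_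
    · exact (hG'c.comp (hφc _)).measurable.enorm.aemeasurable.mul hDu.1.enorm
    · exact ae_of_all _ fun x => by dsimp only; gcongr; exact hm _
    · rw [lintegral_const_mul' _ _ ENNReal.ofReal_ne_top]
      exact ENNReal.mul_ne_top ENNReal.ofReal_ne_top hDu1
    · filter_upwards [hae] with x hx
      exact ENNReal.Tendsto.mul_const
        ((continuous_enorm.tendsto _).comp ((hG'c.tendsto _).comp hx)) (.inr enorm_ne_top)
  have hR2 : Tendsto (fun k => ∫⁻ x, ‖gradient (φ (ns k)) x - Du x‖ₑ ∂ν) atTop (𝓝 0) := by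
    have hbd (k : ℕ) : ∫⁻ x, ‖gradient (φ k) x - Du x‖ₑ ∂ν ≤
        eLpNorm (fun x => gradient (φ k) x - Du x) 2 ν *
          ν Set.univ ^ (1 / (1 : ℝ≥0∞).toReal - 1 / (2 : ℝ≥0∞).toReal) := by
      rw [← eLpNorm_one_eq_lintegral_enorm]
      exact eLpNorm_le_eLpNorm_mul_rpow_measure_univ (by norm_num)
        ((hgc k).aestronglyMeasurable.sub hDu.1)
    have hz := ENNReal.Tendsto.mul_const (b := ν Set.univ ^ (1 / (1 : ℝ≥0∞).toReal -
      1 / (2 : ℝ≥0∞).toReal)) (hlim'.comp hns.tendsto_atTop)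
      (.inr (ENNReal.rpow_ne_top_of_nonneg (by norm_num) (measure_ne_top _ _)))
    rw [zero_mul] at hz
    exact tendsto_of_tendsto_of_tendsto_of_le_of_le tendsto_const_nhds hz
      (fun _ => zero_le) fun k => hbd (ns k)
  -- The bound |G'(φₖ)||∇φₖ| ≤ m|∇φₖ - Du| + |G'(φₖ)||Du| keeps the weight G'(u) in the limit, and
  -- with it the localisation to 0 < u < 1/2.
  have hR : Tendsto (fun k => 2 ^ n * (volume A + volume D) *
      (ENNReal.ofReal m * ∫⁻ x, ‖gradient (φ (ns k)) x - Du x‖ₑ ∂ν +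
        ∫⁻ x, ‖deriv G (φ (ns k) x)‖ₑ * ‖Du x‖ₑ ∂ν)) atTop
      (𝓝 (2 ^ n * (volume A + volume D) * ∫⁻ x, ‖deriv G (u x)‖ₑ * ‖Du x‖ₑ ∂ν)) := by
    have hfin (S : Set (EuclideanSpace ℝ (Fin n))) (hS : S ⊆ Metric.ball 0 1) : volume S ≠ ⊤ :=
      ((measure_mono hS).trans_lt measure_ball_lt_top).ne
    refine ENNReal.Tendsto.const_mul ?_ (.inr (ENNReal.mul_ne_top (by simp)
      (ENNReal.add_ne_top.2 ⟨hfin A hA, hfin D hD⟩)))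
    simpa using (ENNReal.Tendsto.const_mul hR2 (.inr ENNReal.ofReal_ne_top)).add hR1
  refine le_of_tendsto_of_tendsto' hL hR fun k => ?_
  have hGφ : ContDiff ℝ ∞ fun x => G (φ (ns k) x) := hG.comp (hφ _)
  have hint : IntegrableOn (fun x => G (φ (ns k) x)) (Metric.ball 0 1) :=
    Integrable.of_bound hGφ.continuous.aestronglyMeasurable M (ae_of_all _ fun x => hGM _)
  refine (measure_mul_integral_sub_le (hGφ.of_le (by simp)) hint hA hD).trans ?_
  gcongr
  have hmeas : AEMeasurable
      (fun x => ENNReal.ofReal m * ‖gradient (φ (ns k)) x - Du x‖ₑ) ν :=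
    ((hgc _).aestronglyMeasurable.sub hDu.1).enorm.const_mul _
  rw [← lintegral_const_mul' _ _ ENNReal.ofReal_ne_top, ← lintegral_add_left' hmeas]
  refine lintegral_mono fun x => ?_
  rw [gradient_comp (hG.differentiable (by simp) _) ((hφ _).differentiable (by simp) _),
    enorm_smul]
  calc ‖deriv G (φ (ns k) x)‖ₑ * ‖gradient (φ (ns k)) x‖ₑ
      = ‖deriv G (φ (ns k) x)‖ₑ * ‖gradient (φ (ns k)) x - Du x + Du x‖ₑ := by
        rw [sub_add_cancel]
    _ ≤ ‖deriv G (φ (ns k) x)‖ₑ * (‖gradient (φ (ns k)) x - Du x‖ₑ + ‖Du x‖ₑ) := by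
        gcongr; exact enorm_add_le _ _
    _ ≤ _ := by
        rw [mul_add]
        gcongr
        exact hm _

end Limit

/-! ### De Giorgi's isoperimetric inequality -/

section Isoperimetric

variable {n : ℕ} {u : EuclideanSpace ℝ (Fin n) → ℝ}
  {Du : EuclideanSpace ℝ (Fin n) → EuclideanSpace ℝ (Fin n)}

/-- De Giorgi's isoperimetric inequality between the levels `0` and `1 / 2`. -/
lemma isoperimetric_le (hu : IsH1With (Metric.ball 0 2) u Du) :
    volume.real {x | x ∈ Metric.ball (0 : EuclideanSpace ℝ (Fin n)) 1 ∧ u x = 0} *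
        volume.real {x | x ∈ Metric.ball (0 : EuclideanSpace ℝ (Fin n)) 1 ∧ 1 / 2 ≤ u x} ≤
      2 ^ n * volume.real (Metric.ball (0 : EuclideanSpace ℝ (Fin n)) 1) * (5 / 2) *
        (√(volume.real {x | x ∈ Metric.ball (0 : EuclideanSpace ℝ (Fin n)) 1 ∧
          0 < u x ∧ u x < 1 / 2}) * √(∫ x in Metric.ball 0 1, ‖Du x‖ ^ 2)) := by
  set B := Metric.ball (0 : EuclideanSpace ℝ (Fin n)) 1
  set A := {x | x ∈ B ∧ u x = 0}
  set D := {x | x ∈ B ∧ 1 / 2 ≤ u x}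
  set C := {x | x ∈ B ∧ 0 < u x ∧ u x < 1 / 2}
  have hA : A ⊆ B := fun x hx => hx.1
  have hD : D ⊆ B := fun x hx => hx.1
  have hC : C ⊆ B := fun x hx => hx.1
  have hBm : MeasurableSet B := measurableSet_ball
  have hB12 : B ⊆ Metric.ball 0 2 := Metric.ball_subset_ball one_le_two
  have huB := hu.mono hB12
  have hnull {S : Set ℝ} (hS : MeasurableSet S) : NullMeasurableSet {x | x ∈ B ∧ u x ∈ S} := by
    have h := (nullMeasurableSet_restrict hBm.nullMeasurableSet).1
      (huB.memLp.1.aemeasurable.nullMeasurable hS)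
    rwa [Set.inter_comm] at h
  have hAm : NullMeasurableSet A := hnull (measurableSet_singleton 0)
  have hDm : NullMeasurableSet D := hnull measurableSet_Ici
  have hCm : NullMeasurableSet C := hnull measurableSet_Ioo
  obtain ⟨G, hG, hG0, hG1, hGd, hGm, hGz⟩ :=
    exists_smooth_step (a := 0) (b := 1 / 2) (m := 5 / 2) (by norm_num) (by norm_num)
  -- Since η = 1 on B₁, the approximants of ηu converge there to `u`, and their gradients to `Du`.
  obtain ⟨η, hη, hη1, -⟩ := exists_cutoff n
  have hv := hu.testFunction_mul_isH10With Metric.isOpen_ball hη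
  obtain ⟨φ, hφ, hlim, hlim'⟩ := hv.exists_approx
  have hres {F : Type} [NormedAddCommGroup F] {f g : ℕ → EuclideanSpace ℝ (Fin n) → F}
      (hf : Tendsto (fun k => eLpNorm (f k) 2 (volume.restrict (Metric.ball 0 2))) atTop (𝓝 0))
      (hfg : ∀ k, ∀ x ∈ B, f k x = g k x) :
      Tendsto (fun k => eLpNorm (g k) 2 (volume.restrict B)) atTop (𝓝 0) := by
    refine tendsto_of_tendsto_of_tendsto_of_le_of_le tendsto_const_nhds hf (fun _ => zero_le)
      fun k => ?_
    calc eLpNorm (g k) 2 (volume.restrict B) = eLpNorm (f k) 2 (volume.restrict B) :=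
          eLpNorm_congr_ae ((ae_restrict_mem hBm).mono fun x hx => (hfg k x hx).symm)
      _ ≤ _ := eLpNorm_mono_measure _ (Measure.restrict_mono hB12 le_rfl)
  have hηgrad : ∀ x ∈ B, gradient η x = 0 := fun x hx => by
    have : η =ᶠ[𝓝 x] fun _ => 1 := by
      filter_upwards [Metric.isOpen_ball.mem_nhds hx] with y hy using hη1 y hy
    rw [this.gradient_eq, gradient_fun_const]
  have hGM : ∀ t, ‖G t‖ ≤ 1 := fun t => by
    have hmono : Monotone G := monotone_of_deriv_nonneg (hG.differentiable (by simp)) hGd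
    have h0 : 0 ≤ G t := (hG0 (min t 0) (min_le_right _ _)).ge.trans (hmono (min_le_left _ _))
    have h1 : G t ≤ 1 := (hmono (le_max_left t (1 / 2))).trans (hG1 _ (le_max_right _ _)).le
    rwa [Real.norm_of_nonneg h0]
  have key := measure_mul_integral_sub_le_of_tendsto (fun k => (hφ k).1) huB.memLp.1
    huB.memLp_grad
    (hres hlim fun k x hx => by simp only [hη1 x hx, one_mul])
    (hres hlim' fun k x hx => by simp only [hη1 x hx, hηgrad x hx, one_smul, smul_zero, add_zero])
    hG hGM (m := 5 / 2) (fun t => by rw [Real.norm_of_nonneg (hGd t)]; exact hGm t) hA hD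
  have hintA : ∫ x in A, G (u x) = 0 := by
    refine integral_eq_zero_of_ae ?_
    filter_upwards [ae_restrict_mem₀ hAm] with x hx
    exact hG0 _ hx.2.le
  have hintD : ∫ x in D, G (u x) = volume.real D := by
    calc ∫ x in D, G (u x) = ∫ _ in D, (1 : ℝ) := by
          refine integral_congr_ae ?_
          filter_upwards [ae_restrict_mem₀ hDm] with x hx
          exact hG1 _ hx.2
      _ = _ := by simp
  rw [hintA, hintD, mul_zero, sub_zero] at key
  have hAD : volume A + volume D ≤ volume B := by
    rw [← measure_union₀ hDm (Disjoint.aedisjoint (Set.disjoint_left.2 fun x hx hx' => by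
      have h1 := hx.2
      have h2 := hx'.2
      linarith))]
    exact measure_mono (Set.union_subset hA hD)
  have hBfin : volume B ≠ ⊤ := measure_ball_lt_top.ne
  have hCfin : volume C ≠ ⊤ := ((measure_mono hC).trans_lt hBfin.lt_top).ne
  -- G'(u) is at most 5/2 times the indicator of `C`, so Cauchy–Schwarz pairs that indicator with
  -- |Du|.
  have hholder : ∫⁻ x in B, ‖deriv G (u x)‖ₑ * ‖Du x‖ₑ ≤
      ENNReal.ofReal (5 / 2 * (√(volume.real C) * √(∫ x in B, ‖Du x‖ ^ 2))) := by
    have hCν : NullMeasurableSet C (volume.restrict B) := hCm.mono_ac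
      Measure.absolutelyContinuous_restrict
    have h := ENNReal.lintegral_mul_le_Lp_mul_Lq (volume.restrict B) Real.HolderConjugate.two_two
      (f := C.indicator fun _ => 1) (g := fun x => ‖Du x‖ₑ)
      (aemeasurable_const.indicator₀ hCν) huB.memLp_grad.1.enorm
    have e1 : ∫⁻ x in B, (C.indicator (fun _ => (1 : ℝ≥0∞)) x) ^ (2 : ℝ) =
        ENNReal.ofReal (volume.real C) := by
      have : (fun x => (C.indicator (fun _ => (1 : ℝ≥0∞)) x) ^ (2 : ℝ)) =
          C.indicator fun _ => 1 := by
        ext x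
        by_cases hx : x ∈ C <;> simp [hx]
      rw [this, lintegral_indicator₀ hCν, setLIntegral_one, Measure.restrict_apply' hBm,
        Set.inter_eq_left.2 hC, ofReal_measureReal hCfin]
    have e2 : ∫⁻ x in B, ‖Du x‖ₑ ^ (2 : ℝ) = ENNReal.ofReal (∫ x in B, ‖Du x‖ ^ 2) := by
      rw [ofReal_integral_eq_lintegral_ofReal
        (huB.memLp_grad.integrable_norm_pow two_ne_zero) (ae_of_all _ fun x => by positivity)]
      refine lintegral_congr fun x => ?_
      rw [ENNReal.ofReal_pow (norm_nonneg _), ofReal_norm, ENNReal.rpow_two]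
    rw [e1, e2, ENNReal.ofReal_rpow_of_nonneg (by positivity) (by positivity),
      ENNReal.ofReal_rpow_of_nonneg (integral_nonneg fun x => by positivity) (by positivity),
      ← Real.sqrt_eq_rpow, ← Real.sqrt_eq_rpow, ← ENNReal.ofReal_mul (by positivity)] at h
    rw [ENNReal.ofReal_mul (by positivity)]
    refine le_trans ?_ (mul_le_mul_right h _)
    rw [← lintegral_const_mul' _ _ ENNReal.ofReal_ne_top]
    refine lintegral_mono_ae ?_
    filter_upwards [ae_restrict_mem hBm] with x hx
    by_cases hxC : x ∈ C
    · simp only [Pi.mul_apply, Set.indicator_of_mem hxC, one_mul]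
      gcongr
      rw [← ofReal_norm, Real.norm_of_nonneg (hGd _)]
      exact ENNReal.ofReal_le_ofReal (hGm _)
    · rw [hGz _ fun h => hxC ⟨hx, h⟩]
      simp
  have hfinal : ENNReal.ofReal (volume.real A * volume.real D) ≤
      ENNReal.ofReal (2 ^ n * volume.real B *
        (5 / 2 * (√(volume.real C) * √(∫ x in B, ‖Du x‖ ^ 2)))) := by
    rw [ENNReal.ofReal_mul (p := 2 ^ n * volume.real B) (by positivity),
      ENNReal.ofReal_mul (p := 2 ^ n) (by positivity), ofReal_measureReal hBfin,
      ENNReal.ofReal_pow two_pos.le, ENNReal.ofReal_ofNat]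
    refine key.trans ?_
    gcongr
  have := (ENNReal.ofReal_le_ofReal_iff (by positivity)).1 hfinal
  rw [mul_assoc _ (5 / 2 : ℝ)]
  exact this

end Isoperimetric

end Auxiliary

/-! ### Combining energy and isoperimetry -/

theorem mainTheorem5 (n : ℕ) (hn : 1 ≤ n) (lam Lam : ℝ)
    (a : EuclideanSpace ℝ (Fin n) → Matrix (Fin n) (Fin n) ℝ)
    (ha : IsUniformlyElliptic (Metric.ball 0 2) lam Lam a)
    (u : EuclideanSpace ℝ (Fin n) → ℝ)
    (hu : IsSubsolution (Metric.ball 0 2) a u)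
    (hu01 : ∀ᵐ x ∂(volume.restrict (Metric.ball (0 : EuclideanSpace ℝ (Fin n)) 2)),
      0 ≤ u x ∧ u x ≤ 1)
    (κ : ℝ) (hκ : 0 < κ)
    (hzero : volume.real (Metric.ball (0 : EuclideanSpace ℝ (Fin n)) 1) / 2 ≤
      volume.real {x | x ∈ Metric.ball (0 : EuclideanSpace ℝ (Fin n)) 1 ∧ u x = 0})
    (hhalf : κ * volume.real (Metric.ball (0 : EuclideanSpace ℝ (Fin n)) 1) ≤
      volume.real {x | x ∈ Metric.ball (0 : EuclideanSpace ℝ (Fin n)) 1 ∧ 1 / 2 ≤ u x}) :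
    κ ^ 2 * volume.real (Metric.ball (0 : EuclideanSpace ℝ (Fin n)) 1) /
        ((n : ℝ) ^ 2 * 2 ^ (3 * n + 6) * energyConst n lam Lam) ≤
      volume.real {x | x ∈ Metric.ball (0 : EuclideanSpace ℝ (Fin n)) 1 ∧
        0 < u x ∧ u x < 1 / 2} := by
  obtain ⟨Du, hDu, hsub⟩ := hu
  have hE := setIntegral_norm_grad_sq_le ha hDu hsub hu01
  have hI := isoperimetric_le hDu
  set W := volume.real (Metric.ball (0 : EuclideanSpace ℝ (Fin n)) 1)
  set A := volume.real {x | x ∈ Metric.ball (0 : EuclideanSpace ℝ (Fin n)) 1 ∧ u x = 0}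
  set D := volume.real {x | x ∈ Metric.ball (0 : EuclideanSpace ℝ (Fin n)) 1 ∧ 1 / 2 ≤ u x}
  set c := volume.real {x | x ∈ Metric.ball (0 : EuclideanSpace ℝ (Fin n)) 1 ∧
        0 < u x ∧ u x < 1 / 2}
  set I := ∫ x in Metric.ball 0 1, ‖Du x‖ ^ 2
  set K := energyConst n lam Lam with hK
  have hW : 0 < W := ENNReal.toReal_pos (Metric.measure_ball_pos _ _ one_pos).ne'
    measure_ball_lt_top.ne
  have hn' : (1 : ℝ) ≤ n := by exact_mod_cast hn
  have hc : 0 ≤ c := measureReal_nonneg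
  have hKpos : 0 < K := by
    have := ha.lam_pos
    have := this.trans_le ha.lam_le
    rw [hK, energyConst]; positivity
  have hI0 : 0 ≤ I := integral_nonneg fun x => by positivity
  have h1 : κ * W ^ 2 / 2 ≤ 2 ^ n * W * (5 / 2) * (√c * √I) := by
    refine le_trans ?_ hI
    calc κ * W ^ 2 / 2 = W / 2 * (κ * W) := by ring
      _ ≤ A * D := by gcongr
  have h2 : (κ * W ^ 2 / 2) ^ 2 ≤ (2 ^ n * W * (5 / 2)) ^ 2 *
      (c * (K * (25 / 16 * (2 ^ n * W)))) := by
    calc (κ * W ^ 2 / 2) ^ 2 ≤ (2 ^ n * W * (5 / 2) * (√c * √I)) ^ 2 := by gcongr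
      _ = (2 ^ n * W * (5 / 2)) ^ 2 * (c * I) := by
          rw [mul_pow, mul_pow (√c), Real.sq_sqrt hc, Real.sq_sqrt hI0]
      _ ≤ _ := by gcongr
  have h3 : W ^ 3 * (κ ^ 2 * W) ≤ W ^ 3 * (c * (2 ^ (3 * n + 6) * K)) := by
    have e : (2 : ℝ) ^ (3 * n + 6) = ((2 : ℝ) ^ n) ^ 3 * 64 := by
      rw [pow_add, mul_comm 3 n, pow_mul]; norm_num
    have hpos : 0 ≤ W ^ 3 * (((2 : ℝ) ^ n) ^ 3 * (c * K)) := by positivity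
    rw [e]
    -- After multiplication by 4, `h2` carries the constant 4 · (5/2)² · (25/16) = 625/16, which is
    -- below 64 = 2⁶; `hpos` absorbs the difference.
    nlinarith [h2, hpos]
  have h4 : κ ^ 2 * W ≤ c * (2 ^ (3 * n + 6) * K) := le_of_mul_le_mul_left h3 (by positivity)
  rw [div_le_iff₀ (by positivity)]
  calc κ ^ 2 * W ≤ c * (2 ^ (3 * n + 6) * K) := h4
    _ = c * (1 ^ 2 * 2 ^ (3 * n + 6) * K) := by ring
    _ ≤ c * ((n : ℝ) ^ 2 * 2 ^ (3 * n + 6) * K) := by gcongr
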